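/- **Proposition 5.3 (Hölder continuity in the spatial variable).** Let $(\Omega,\mathcal F,(\mathcal F_t)_{t\ge 0},\mathbb P)$ be a filtered probability space and $W$ a standard real Brownian motion relative to $(\mathcal F_t)$ (that is, $W$ is adapted and $W(t)-W(s)$ is independent of $\mathcal F_s$ for $s\le t$). Let $a\le b$, $K=[a,b]$, $X=C([a,b])$, $T\ge 0$ and $t\in[0,T]$. An *elementary process* on $[0,T]$ is a process $x=\sum_{i=0}^n x_i\mathbf 1_{[t_i,t_{i+1})}$ with $0=t_0\le t_1\le\dots\le t_{n+1}=T$ and $x_i\in L^2((\Omega,\mathcal F_{t_i});X)$; its integral is $\int_0^t x\,dW=\sum_{i=0}^n x_i\,(W(t_{i+1}\wedge t)-W(t_i\wedge t))$. Let $\mathcal M_W$ be the completion of the space of elementary processes in the norm $\|x\|=\big\|\mathbb E\int_0^T x(s)^2\,ds\big\|_{C([a,b])}^{1/2}=\sup_{\sigma}\|x(\sigma)\|_{L^2([0,T]\times\Omega)}$, regarded as a closed subspace of $C([a,b];L^2([0,T]\times\Omega))$, and let $\mathcal M_t$ be the completion of $L^2((\Omega,\mathcal F_t);X)$ in the norm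 $\|\mathbb E[z^2]\|_{C([a,b])}^{1/2}$, regarded as a closed subspace of $C([a,b];L^2(\Omega))$. For $x\in\mathcal M_W$, the *Itô integral* $\int_0^t x\,dW$ is the element $z\in\mathcal M_t$ such that $\int_0^t x_n\,dW\to z$ in $\mathcal M_t$ for every sequence of elementary processes $x_n\to x$ in $\mathcal M_W$. Let $x\in\mathcal M_W$, and suppose that there are $\beta>\tfrac12$ and a random variable $L$ with $\mathbb E[L^2]<\infty$ such that, for all $\tau,\sigma\in[a,b]$, $$|x(\tau)(s,\omega)-x(\sigma)(s,\omega)|\le L(\omega)\,|\tau-\sigma|^\beta\qquad\text{for almost every }(s,\omega)\in[0,t]\times\Omega .$$ Then the Itô integral $z=\int_0^t x\,dW$ exists and is unique, and the random field $\sigma\mapsto z(\sigma)=\big(\int_0^t x\,dW\big)(\sigma)$ has a version that is Hölder continuous of every order $\gamma\in(0,\beta-\tfrac12)$: there are random variables $Y(\sigma)$, $\sigma\in[a,b]$, with $Y(\sigma)=z(\sigma)$ a.s. for each $\sigma$, such that for every $\gamma\in(0,\beta-\tfrac12)$ and every $\omega\in\Omega$ there is a $C<\infty$ with $|Y(\tau)(\omega)-Y(\sigma)(\omega)|\le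 C|\tau-\sigma|^\gamma$ for all $\tau,\sigma\in[a,b]$. -/

import Mathlib

open MeasureTheory ProbabilityTheory Filter Topology
open scoped NNReal ENNReal

namespace SpatialIto

section FieldEmbedding

variable {S K : Type*} [MeasurableSpace S] [MetricSpace K] [CompactSpace K]

theorem memLp_const_zero {E : Type*} [NormedAddCommGroup E] {μ : Measure S} :
    MemLp (fun _ : S => (0 : E)) 2 μ :=
  MemLp.zero'

theorem memLp_indicator_aux {E : Type*} [NormedAddCommGroup E] {μ : Measure S} {A : Set S}
    (hA : MeasurableSet A) {f : S → E} (hf : MemLp f 2 μ) : MemLp (A.indicator f) 2 μ :=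
  hf.indicator hA

theorem memLp_sum_aux {E ι : Type*} [NormedAddCommGroup E] [Fintype ι] {μ : Measure S}
    {f : ι → S → E} (hf : ∀ i, MemLp (f i) 2 μ) : MemLp (fun s => ∑ i, f i s) 2 μ :=
  memLp_finsetSum Finset.univ fun i _ => hf i

theorem memLp_eval {μ : Measure S} {f : S → C(K, ℝ)} (hf : MemLp f 2 μ) (k : K) :
    MemLp (fun s => f s k) 2 μ :=
  (ContinuousMap.evalCLM ℝ k : C(K, ℝ) →L[ℝ] ℝ).comp_memLp' hf

theorem norm_sq_toLp {μ : Measure S} {g : S → ℝ} (hg : MemLp g 2 μ) :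
    ‖hg.toLp g‖ ^ 2 = ∫ s, g s * g s ∂μ := by
  rw [← real_inner_self_eq_norm_sq, L2.inner_def]
  refine integral_congr_ae ?_
  filter_upwards [hg.coeFn_toLp] with s hs
  simp [hs, pow_two]

/-- The embedding of `L²(S; C(K))` into `C(K; L²(S))` by change of the order of the variables:
`f` is sent to `k ↦ [s ↦ f s k]`. -/
noncomputable def toField {μ : Measure S} (f : S → C(K, ℝ)) (hf : MemLp f 2 μ) :
    C(K, Lp ℝ 2 μ) where
  toFun k := (memLp_eval hf k).toLp (fun s => f s k)
  continuous_toFun := by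
    rw [continuous_iff_continuousAt]
    intro l
    have hsub : ∀ k, MemLp (fun s => f s k - f s l) 2 μ := fun k =>
      (memLp_eval hf k).sub (memLp_eval hf l)
    have hI : Continuous (fun k => ∫ s, (f s k - f s l) * (f s k - f s l) ∂μ) := by
      refine continuous_of_dominated (bound := fun s => 4 * ‖f s‖ ^ 2) ?_ ?_ ?_ ?_
      · intro k
        exact (hsub k).1.mul (hsub k).1
      · intro k
        refine Eventually.of_forall fun s => ?_
        have h1 := (f s).norm_coe_le_norm k
        have h2 := (f s).norm_coe_le_norm l
        have h3 : ‖f s k - f s l‖ ≤ 2 * ‖f s‖ := (norm_sub_le _ _).trans (by linarith)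
        rw [norm_mul]
        nlinarith [norm_nonneg (f s k - f s l), norm_nonneg (f s)]
      · exact (hf.integrable_norm_pow (by norm_num)).const_mul 4
      · refine Eventually.of_forall fun s => ?_
        fun_prop
    have h0 := hI.tendsto l
    simp only [sub_self, mul_zero, integral_zero] at h0
    rw [ContinuousAt, tendsto_iff_norm_sub_tendsto_zero]
    have h1 := (Real.continuous_sqrt.tendsto 0).comp h0
    rw [Real.sqrt_zero] at h1
    refine h1.congr fun k => ?_
    rw [← MemLp.toLp_sub]
    have h2 := norm_sq_toLp (hsub k)
    simp only [Function.comp]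
    rw [← h2, Real.sqrt_sq (norm_nonneg _)]
    rfl

/-- The supremum norm of `C(K; L²(S))` restricts, on `L²(S; C(K))`, to the norm
`‖∫ f² dμ‖ ^ (1/2)` taken in `C(K)`. Hence the completion of a subspace of `L²(S; C(K))` with
respect to that norm is its closure in the complete space `C(K; L²(S))`. -/
theorem norm_toField_sq {μ : Measure S} (f : S → C(K, ℝ)) (hf : MemLp f 2 μ) :
    ‖toField f hf‖ ^ 2 = ‖∫ s, f s * f s ∂μ‖ := by
  have hint : Integrable (fun s => f s * f s) μ := by
    refine (hf.integrable_norm_pow (by norm_num)).mono' (hf.1.mul hf.1) ?_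
    refine Eventually.of_forall fun s => ?_
    rw [pow_two]
    exact norm_mul_le _ _
  have hk : ∀ k, ‖toField f hf k‖ ^ 2 = ‖(∫ s, f s * f s ∂μ) k‖ := by
    intro k
    rw [ContinuousMap.integral_apply hint]
    change ‖(memLp_eval hf k).toLp (fun s => f s k)‖ ^ 2 = _
    rw [norm_sq_toLp, Real.norm_of_nonneg]
    · rfl
    · exact integral_nonneg fun s => mul_self_nonneg _
  apply le_antisymm
  · rw [← Real.le_sqrt (norm_nonneg _) (norm_nonneg _),
      ContinuousMap.norm_le _ (Real.sqrt_nonneg _)]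
    intro k
    rw [Real.le_sqrt (norm_nonneg _) (norm_nonneg _), hk]
    exact ContinuousMap.norm_coe_le_norm _ k
  · rw [ContinuousMap.norm_le _ (by positivity)]
    intro k
    rw [← hk]
    gcongr
    exact ContinuousMap.norm_coe_le_norm _ k

end FieldEmbedding

section Integral

variable {Ω : Type*} [mΩ : MeasurableSpace Ω]

/-- `W` is a standard real Brownian motion relative to the filtration `ℱ`: it is a Brownian motion,
it is adapted to `ℱ`, and its increments after time `s` are independent of `ℱ s`. -/
structure IsBrownianMotion (W : ℝ≥0 → Ω → ℝ) (ℱ : Filtration ℝ≥0 mΩ) (P : Measure Ω) : Prop where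
  isBrownianReal : IsBrownianReal W P
  adapted : StronglyAdapted ℱ W
  indep_increment : ∀ s t : ℝ≥0, s ≤ t →
    Indep (MeasurableSpace.comap (fun ω => W t ω - W s ω) inferInstance) (ℱ s) P

/-- The measure `ds ⊗ P` on `[0,T] × Ω`. -/
noncomputable def timeProd (T : ℝ≥0) (P : Measure Ω) : Measure (ℝ × Ω) :=
  ((volume : Measure ℝ).restrict (Set.Icc 0 (T : ℝ))).prod P

/-- An elementary `C(K)`-valued process `∑ i, x_i 1_[t_i, t_(i+1))` on `[0,T]`, where
`0 = t_0 ≤ ⋯ ≤ t_(n+1) = T` and `x_i ∈ L²((Ω, ℱ t_i); C(K))`. -/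
structure ElementaryProcess (K : Type*) [MetricSpace K] [CompactSpace K]
    (ℱ : Filtration ℝ≥0 mΩ) (P : Measure Ω) (T : ℝ≥0) where
  n : ℕ
  time : Fin (n + 2) → ℝ≥0
  time_mono : Monotone time
  time_zero : time 0 = 0
  time_last : time (Fin.last (n + 1)) = T
  coeff : Fin (n + 1) → Ω → C(K, ℝ)
  coeff_meas : ∀ i, StronglyMeasurable[ℱ (time i.castSucc)] (coeff i)
  coeff_memLp : ∀ i, MemLp (coeff i) 2 P

namespace ElementaryProcess

variable {K : Type*} [MetricSpace K] [CompactSpace K]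
  {ℱ : Filtration ℝ≥0 mΩ} {P : Measure Ω} {T : ℝ≥0}

/-- The process as a function of `(s, ω)`. -/
noncomputable def toFun (u : ElementaryProcess K ℱ P T) (p : ℝ × Ω) : C(K, ℝ) :=
  ∑ i : Fin (u.n + 1),
    (Set.Ico (u.time i.castSucc : ℝ) (u.time i.succ)).indicator (fun _ => u.coeff i p.2) p.1

theorem memLp_toFun [IsProbabilityMeasure P] (u : ElementaryProcess K ℱ P T) :
    MemLp u.toFun 2 (timeProd T P) := by
  have h : ∀ i ∈ (Finset.univ : Finset (Fin (u.n + 1))),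
      MemLp (fun p : ℝ × Ω => (Set.Ico (u.time i.castSucc : ℝ) (u.time i.succ)).indicator
        (fun _ => u.coeff i p.2) p.1) 2 (timeProd T P) := by
    intro i _
    have h1 : MemLp (fun p : ℝ × Ω => u.coeff i p.2) 2 (timeProd T P) :=
      (u.coeff_memLp i).comp_snd ((volume : Measure ℝ).restrict (Set.Icc 0 (T : ℝ)))
    have hs : MeasurableSet
        ((Prod.fst : ℝ × Ω → ℝ) ⁻¹' Set.Ico (u.time i.castSucc : ℝ) (u.time i.succ)) :=
      measurable_fst measurableSet_Ico
    have h2 := memLp_indicator_aux hs h1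
    have he : (fun p : ℝ × Ω => (Set.Ico (u.time i.castSucc : ℝ) (u.time i.succ)).indicator
        (fun _ => u.coeff i p.2) p.1) =
        ((Prod.fst : ℝ × Ω → ℝ) ⁻¹' Set.Ico (u.time i.castSucc : ℝ) (u.time i.succ)).indicator
          (fun p : ℝ × Ω => u.coeff i p.2) := by
      funext p
      by_cases hp : p.1 ∈ Set.Ico (u.time i.castSucc : ℝ) (u.time i.succ)
      · rw [Set.indicator_of_mem hp, Set.indicator_of_mem (s := Prod.fst ⁻¹' _) hp]
      · rw [Set.indicator_of_notMem hp, Set.indicator_of_notMem (s := Prod.fst ⁻¹' _) hp]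
    rw [he]
    exact h2
  exact memLp_sum_aux fun i => h i (Finset.mem_univ i)

/-- The stochastic integral `∑ i, x_i (W (t_(i+1) ∧ t) - W (t_i ∧ t))` of an elementary process. -/
noncomputable def integralFun (u : ElementaryProcess K ℱ P T) (W : ℝ≥0 → Ω → ℝ) (t : ℝ≥0)
    (ω : Ω) : C(K, ℝ) :=
  ∑ i : Fin (u.n + 1),
    (W (min (u.time i.succ) t) ω - W (min (u.time i.castSucc) t) ω) • u.coeff i ω

theorem memLp_integralFun {W : ℝ≥0 → Ω → ℝ} (hW : IsBrownianMotion W ℱ P)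
    (u : ElementaryProcess K ℱ P T) (t : ℝ≥0) : MemLp (u.integralFun W t) 2 P := by
  unfold integralFun
  refine memLp_sum_aux fun i => ?_
  have hle : u.time i.castSucc ≤ u.time i.succ := u.time_mono (Fin.castSucc_le_succ i)
  rcases le_total t (u.time i.castSucc) with h | h
  · rw [min_eq_right h, min_eq_right (h.trans hle)]
    simp only [sub_self, zero_smul]
    exact memLp_const_zero
  · rw [min_eq_left h]
    have hst : u.time i.castSucc ≤ min (u.time i.succ) t := le_min hle h
    have hD : MemLp (fun ω => W (min (u.time i.succ) t) ω - W (u.time i.castSucc) ω) 2 P :=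
      (hW.isBrownianReal.isGaussianProcess.hasGaussianLaw_eval _).memLp_two.sub
        (hW.isBrownianReal.isGaussianProcess.hasGaussianLaw_eval _).memLp_two
    have hX := u.coeff_memLp i
    have hXm := u.coeff_meas i
    have hind : IndepFun (fun ω => W (min (u.time i.succ) t) ω - W (u.time i.castSucc) ω)
        (fun ω => ‖u.coeff i ω‖) P := by
      rw [IndepFun_iff_Indep]
      exact indep_of_indep_of_le_right (hW.indep_increment _ _ hst)
        hXm.norm.measurable.comap_le
    have hind2 := hind.comp (φ := fun r : ℝ => r ^ 2) (ψ := fun r : ℝ => r ^ 2)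
      (by fun_prop) (by fun_prop)
    have hint := hind2.integrable_mul hD.integrable_sq
      (hX.integrable_norm_pow (by norm_num))
    refine (memLp_two_iff_integrable_sq_norm (hD.1.smul hX.1)).2 (hint.congr ?_)
    refine Eventually.of_forall fun ω => ?_
    simp [norm_smul, mul_pow]

/-- An elementary process as an element of `C(K; L²([0,T] × Ω))`. -/
noncomputable def field [IsProbabilityMeasure P] (u : ElementaryProcess K ℱ P T) :
    C(K, Lp ℝ 2 (timeProd T P)) :=
  toField u.toFun u.memLp_toFun

/-- The stochastic integral over `[0,t]` of an elementary process, as an element of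
`C(K; L²(Ω))`. -/
noncomputable def integral {W : ℝ≥0 → Ω → ℝ} (hW : IsBrownianMotion W ℱ P)
    (u : ElementaryProcess K ℱ P T) (t : ℝ≥0) : C(K, Lp ℝ 2 P) :=
  toField (u.integralFun W t) (u.memLp_integralFun hW t)

end ElementaryProcess

/-- The space of stochastically integrable `C(K)`-valued functions on `[0,T] × Ω`: the completion
of the elementary processes in the norm `‖E ∫_0^T x(s)² ds‖ ^ (1/2)` taken in `C(K)`, realised as a
closure in `C(K; L²([0,T] × Ω))`, whose norm restricts to it by `norm_toField_sq`. -/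
def integrands (K : Type*) [MetricSpace K] [CompactSpace K] (ℱ : Filtration ℝ≥0 mΩ)
    (P : Measure Ω) [IsProbabilityMeasure P] (T : ℝ≥0) : Set C(K, Lp ℝ 2 (timeProd T P)) :=
  closure (Set.range fun u : ElementaryProcess K ℱ P T => u.field)

/-- The completion of `L²((Ω, ℱ t); C(K))` in the norm `‖E x²‖ ^ (1/2)` taken in `C(K)`, realised
as a closure in `C(K; L²(Ω))`. -/
def integralSpace (K : Type*) [MetricSpace K] [CompactSpace K] (ℱ : Filtration ℝ≥0 mΩ)
    (P : Measure Ω) (t : ℝ≥0) : Set C(K, Lp ℝ 2 P) :=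
  closure {z | ∃ (f : Ω → C(K, ℝ)) (hf : MemLp f 2 P),
    StronglyMeasurable[ℱ t] f ∧ z = toField f hf}

/-- `z` is the Itô integral `∫_0^t x(s) dW(s)` of the integrand `x`: the integrals over `[0,t]` of
any elementary processes that converge to `x` converge to `z`. -/
structure IsItoIntegral {K : Type*} [MetricSpace K] [CompactSpace K] {ℱ : Filtration ℝ≥0 mΩ}
    {P : Measure Ω} [IsProbabilityMeasure P] {W : ℝ≥0 → Ω → ℝ} (hW : IsBrownianMotion W ℱ P)
    {T : ℝ≥0} (x : C(K, Lp ℝ 2 (timeProd T P))) (t : ℝ≥0) (z : C(K, Lp ℝ 2 P)) : Prop where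
  mem_integrands : x ∈ integrands K ℱ P T
  mem_integralSpace : z ∈ integralSpace K ℱ P t
  tendsto_integral : ∀ u : ℕ → ElementaryProcess K ℱ P T,
    Tendsto (fun n => (u n).field) atTop (𝓝 x) →
    Tendsto (fun n => (u n).integral hW t) atTop (𝓝 z)

end Integral

end SpatialIto

/-!
Itô's isometry for elementary processes, polarized across two processes and two points of `K`,
passes to the closure: for `z = ∫_0^t x dW` the distance of `z τ` and `z σ` in `L²(Ω)` is that of
`x τ` and `x σ` in `L²([0,t] × Ω)`. The Hölder bound on `x` thus becomes
`E |z τ - z σ|² ≤ t E[L²] |τ - σ| ^ (2β)`, and since `2β > 1` the Kolmogorov–Chentsov theorem,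
proved by dyadic chaining, gives a modification that is Hölder of every order below `(2β - 1) / 2`.
-/

namespace SpatialIto

section DyadicChaining

/-- The point `k / 2 ^ n` of the unit interval; it is `1` when `2 ^ n ≤ k`, so that the index `k`
may range over all natural numbers. -/
noncomputable def dyadicPoint (n k : ℕ) : unitInterval :=
  Set.projIcc 0 1 zero_le_one ((k : ℝ) / 2 ^ n)

/-- The largest dyadic point of level `n` below `y`. -/
noncomputable def dyadicFloor (n : ℕ) (y : unitInterval) : unitInterval :=
  dyadicPoint n ⌊(y : ℝ) * 2 ^ n⌋₊

theorem dyadicPoint_succ_two_mul (n k : ℕ) : dyadicPoint (n + 1) (2 * k) = dyadicPoint n k := by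
  unfold dyadicPoint
  congr 1
  rw [Nat.cast_mul, pow_succ', Nat.cast_ofNat, mul_div_mul_left _ _ two_ne_zero]

theorem dyadicPoint_of_two_pow_le {n k : ℕ} (hk : 2 ^ n ≤ k) : dyadicPoint n k = 1 := by
  refine Set.projIcc_of_right_le _ ?_
  rw [one_le_div (by positivity)]
  exact_mod_cast hk

theorem coe_dyadicFloor (n : ℕ) (y : unitInterval) :
    (dyadicFloor n y : ℝ) = ⌊(y : ℝ) * 2 ^ n⌋₊ / 2 ^ n := by
  have h_le : (⌊(y : ℝ) * 2 ^ n⌋₊ : ℝ) ≤ y * 2 ^ n :=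
    Nat.floor_le (mul_nonneg y.2.1 (by positivity))
  have h_mem : (⌊(y : ℝ) * 2 ^ n⌋₊ / 2 ^ n : ℝ) ∈ Set.Icc (0 : ℝ) 1 :=
    ⟨by positivity, ((div_le_iff₀ (by positivity)).2 h_le).trans y.2.2⟩
  rw [dyadicFloor, dyadicPoint, Set.projIcc_of_mem _ h_mem]

theorem edist_le_two_inv_pow_iff {X : Type*} [PseudoMetricSpace X] {x y : X} {n : ℕ} :
    edist x y ≤ 2⁻¹ ^ n ↔ dist x y ≤ 2⁻¹ ^ n := by
  have h_pow : (2⁻¹ : ℝ≥0∞) ^ n = ENNReal.ofReal (2⁻¹ ^ n) := by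
    rw [ENNReal.ofReal_pow (by positivity), ENNReal.ofReal_inv_of_pos two_pos,
      ENNReal.ofReal_ofNat]
  rw [h_pow, edist_le_ofReal (by positivity)]

theorem edist_unitInterval_le_one (y w : unitInterval) : edist y w ≤ 1 := by
  rw [edist_dist]
  exact ENNReal.ofReal_le_one.2 (Real.dist_le_of_mem_Icc_01 y.2 w.2)

theorem edist_dyadicPoint_succ_le (n k : ℕ) :
    edist (dyadicPoint n k) (dyadicPoint n (k + 1)) ≤ 2⁻¹ ^ n := by
  rw [edist_le_two_inv_pow_iff]
  calc dist (dyadicPoint n k) (dyadicPoint n (k + 1))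
      ≤ dist ((k : ℝ) / 2 ^ n) ((k + 1 : ℕ) / 2 ^ n) := by
        simpa [dyadicPoint] using (LipschitzWith.projIcc (zero_le_one' ℝ)).dist_le_mul
          ((k : ℝ) / 2 ^ n) ((k + 1 : ℕ) / 2 ^ n)
    _ = 2⁻¹ ^ n := by
        rw [dist_comm, Real.dist_eq, ← sub_div, Nat.cast_succ, add_sub_cancel_left,
          abs_of_pos (by positivity), one_div, inv_pow]

theorem edist_dyadicFloor_le (n : ℕ) (y : unitInterval) :
    edist (dyadicFloor n y) y ≤ 2⁻¹ ^ n := by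
  have h_pos : (0 : ℝ) < 2 ^ n := by positivity
  have h_le : (⌊(y : ℝ) * 2 ^ n⌋₊ : ℝ) ≤ y * 2 ^ n := Nat.floor_le (mul_nonneg y.2.1 h_pos.le)
  have h_lt : (y : ℝ) * 2 ^ n < ⌊(y : ℝ) * 2 ^ n⌋₊ + 1 := Nat.lt_floor_add_one _
  rw [edist_le_two_inv_pow_iff, dist_comm, Subtype.dist_eq, Real.dist_eq, coe_dyadicFloor,
    inv_pow, ← one_div, ← mul_div_cancel_right₀ (y : ℝ) h_pos.ne', ← sub_div,
    mul_div_cancel_right₀ (y : ℝ) h_pos.ne', abs_of_nonneg (div_nonneg (by linarith) h_pos.le)]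
  gcongr
  linarith

theorem floor_mul_two_pow_succ (n : ℕ) (y : ℝ) :
    ⌊y * 2 ^ (n + 1)⌋₊ = 2 * ⌊y * 2 ^ n⌋₊ ∨ ⌊y * 2 ^ (n + 1)⌋₊ = 2 * ⌊y * 2 ^ n⌋₊ + 1 := by
  have h_half : ⌊y * 2 ^ n⌋₊ = ⌊y * 2 ^ (n + 1)⌋₊ / 2 := by
    rw [← Nat.floor_div_ofNat, pow_succ, ← mul_assoc, mul_div_cancel_right₀ _ two_ne_zero]
  lia

variable {E : Type*} [PseudoEMetricSpace E]

/-- The increments of `f` between neighbouring dyadic points of level `n` are at most `A * ρ ^ n`.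
For `f` a sample path of a random field, this is the event controlled by moment bounds. -/
def HasDyadicIncrementBound (f : unitInterval → E) (A ρ : ℝ≥0∞) : Prop :=
  ∀ n k, edist (f (dyadicPoint n k)) (f (dyadicPoint n (k + 1))) ≤ A * ρ ^ n

namespace HasDyadicIncrementBound

variable {f : unitInterval → E} {A ρ : ℝ≥0∞}

theorem edist_dyadicFloor_succ_le (hf : HasDyadicIncrementBound f A ρ) (hρ : ρ ≤ 1)
    (n : ℕ) (y : unitInterval) :
    edist (f (dyadicFloor n y)) (f (dyadicFloor (n + 1) y)) ≤ A * ρ ^ n := by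
  unfold dyadicFloor
  rw [← dyadicPoint_succ_two_mul n]
  rcases floor_mul_two_pow_succ n y with h | h <;> rw [h]
  · simp
  · exact (hf (n + 1) _).trans (mul_le_mul_right (pow_le_pow_right_of_le_one' hρ n.le_succ) A)

theorem edist_dyadicFloor_dyadicFloor_le (hf : HasDyadicIncrementBound f A ρ) {n : ℕ}
    {y w : unitInterval} (hyw : edist y w ≤ 2⁻¹ ^ n) :
    edist (f (dyadicFloor n y)) (f (dyadicFloor n w)) ≤ A * ρ ^ n := by
  wlog h_le : y ≤ w generalizing y w
  · rw [edist_comm]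
    exact this (edist_comm y w ▸ hyw) (le_of_not_ge h_le)
  have h_dist : (w : ℝ) - y ≤ 2⁻¹ ^ n :=
    (le_abs_self _).trans (edist_le_two_inv_pow_iff.1 (edist_comm y w ▸ hyw))
  have h_lower : ⌊(y : ℝ) * 2 ^ n⌋₊ ≤ ⌊(w : ℝ) * 2 ^ n⌋₊ :=
    Nat.floor_le_floor (mul_le_mul_of_nonneg_right h_le (by positivity))
  have h_upper : ⌊(w : ℝ) * 2 ^ n⌋₊ ≤ ⌊(y : ℝ) * 2 ^ n⌋₊ + 1 := by
    rw [← Nat.floor_add_one (mul_nonneg y.2.1 (by positivity))]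
    refine Nat.floor_le_floor ?_
    calc (w : ℝ) * 2 ^ n ≤ (y + 2⁻¹ ^ n) * 2 ^ n := by gcongr; linarith
      _ = y * 2 ^ n + 1 := by rw [add_mul, ← mul_pow]; norm_num
  unfold dyadicFloor
  rcases Nat.le_and_le_add_one_iff.1 ⟨h_lower, h_upper⟩ with h | h <;> rw [h]
  · simp
  · exact hf n _

theorem exists_tendsto_dyadicFloor [CompleteSpace E] (hf : HasDyadicIncrementBound f A ρ)
    (hA : A ≠ ∞) (hρ : ρ < 1) (y : unitInterval) :
    ∃ e, Tendsto (fun n => f (dyadicFloor n y)) atTop (𝓝 e) :=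
  cauchySeq_tendsto_of_complete <|
    cauchySeq_of_edist_le_geometric ρ A hρ hA fun n => hf.edist_dyadicFloor_succ_le hρ.le n y

theorem edist_lim_le (hf : HasDyadicIncrementBound f A ρ) (hρ : ρ < 1)
    {g : unitInterval → E}
    (hg : ∀ y, Tendsto (fun n => f (dyadicFloor n y)) atTop (𝓝 (g y)))
    {n : ℕ} {y w : unitInterval} (hyw : edist y w ≤ 2⁻¹ ^ n) :
    edist (g y) (g w) ≤ A * (1 + 2 / (1 - ρ)) * ρ ^ n := by
  have h_tail (y : unitInterval) : edist (f (dyadicFloor n y)) (g y) ≤ A * ρ ^ n / (1 - ρ) :=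
    edist_le_of_edist_le_geometric_of_tendsto ρ A
      (fun n => hf.edist_dyadicFloor_succ_le hρ.le n y) (hg y) n
  calc edist (g y) (g w)
      ≤ edist (g y) (f (dyadicFloor n y)) + edist (f (dyadicFloor n y)) (f (dyadicFloor n w))
        + edist (f (dyadicFloor n w)) (g w) := edist_triangle4 _ _ _ _
    _ ≤ A * ρ ^ n / (1 - ρ) + A * ρ ^ n + A * ρ ^ n / (1 - ρ) := by
      rw [edist_comm (g y)]
      gcongr
      exacts [h_tail y, hf.edist_dyadicFloor_dyadicFloor_le hyw, h_tail w]
    _ = A * (1 + 2 / (1 - ρ)) * ρ ^ n := by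
      simp only [div_eq_mul_inv]
      ring

end HasDyadicIncrementBound

theorem exists_two_inv_pow_near {r : ℝ≥0∞} (h_ne : r ≠ 0) (h_le : r ≤ 1) :
    ∃ n : ℕ, r ≤ 2⁻¹ ^ n ∧ 2⁻¹ ^ n ≤ 2 * r := by
  lift r to ℝ≥0 using ne_top_of_le_ne_top ENNReal.one_ne_top h_le
  obtain ⟨n, h_lower, h_upper⟩ := exists_nat_pow_near_of_lt_one
    (pos_iff_ne_zero.2 (ENNReal.coe_ne_zero.1 h_ne)) (ENNReal.coe_le_one_iff.1 h_le)
    (inv_pos.2 (zero_lt_two' ℝ≥0)) (inv_lt_one_of_one_lt₀ one_lt_two)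
  have h_double : (2⁻¹ : ℝ≥0) ^ n ≤ 2 * r :=
    calc (2⁻¹ : ℝ≥0) ^ n = 2 * 2⁻¹ ^ (n + 1) := by
          rw [pow_succ', mul_inv_cancel_left₀ two_ne_zero]
      _ ≤ 2 * r := by gcongr
  refine ⟨n, ?_, ?_⟩
  · simpa only [ENNReal.coe_pow, ENNReal.coe_inv_two] using ENNReal.coe_le_coe.2 h_upper
  · simpa only [ENNReal.coe_mul, ENNReal.coe_ofNat, ENNReal.coe_pow, ENNReal.coe_inv_two]
      using ENNReal.coe_le_coe.2 h_double

theorem holderWith_of_edist_le_pow {X Y : Type*} [EMetricSpace X] [PseudoEMetricSpace Y]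
    {g : X → Y} {c γ : ℝ≥0} (hX : ∀ x y : X, edist x y ≤ 1)
    (hg : ∀ (n : ℕ) (x y : X), edist x y ≤ 2⁻¹ ^ n →
      edist (g x) (g y) ≤ c * ((2⁻¹ : ℝ≥0∞) ^ (γ : ℝ)) ^ n) :
    HolderWith (c * 2 ^ (γ : ℝ)) γ g := by
  intro x y
  rcases eq_or_ne x y with rfl | hxy
  · simp
  obtain ⟨n, h_upper, h_lower⟩ := exists_two_inv_pow_near (edist_pos.2 hxy).ne' (hX x y)
  calc edist (g x) (g y)
      ≤ c * ((2⁻¹ : ℝ≥0∞) ^ (γ : ℝ)) ^ n := hg n x y h_upper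
    _ = c * ((2⁻¹ : ℝ≥0∞) ^ n) ^ (γ : ℝ) := by
      rw [← ENNReal.rpow_mul_natCast, ← ENNReal.rpow_natCast_mul, mul_comm (γ : ℝ)]
    _ ≤ c * (2 * edist x y) ^ (γ : ℝ) := by gcongr
    _ = (c * 2 ^ (γ : ℝ) : ℝ≥0) * edist x y ^ (γ : ℝ) := by
      rw [ENNReal.mul_rpow_of_nonneg _ _ γ.coe_nonneg, ENNReal.coe_mul,
        ENNReal.coe_rpow_of_nonneg _ γ.coe_nonneg, ENNReal.coe_ofNat, mul_assoc]

theorem HasDyadicIncrementBound.exists_holderWith_lim {E : Type*} [PseudoEMetricSpace E]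
    {f : unitInterval → E} {A : ℝ≥0∞} {γ : ℝ≥0}
    (hf : HasDyadicIncrementBound f A (2⁻¹ ^ (γ : ℝ))) (hA : A ≠ ∞) (hγ : 0 < γ)
    {g : unitInterval → E}
    (hg : ∀ y, Tendsto (fun n => f (dyadicFloor n y)) atTop (𝓝 (g y))) :
    ∃ C, HolderWith C γ g := by
  have hρ : (2⁻¹ : ℝ≥0∞) ^ (γ : ℝ) < 1 :=
    ENNReal.rpow_lt_one ENNReal.one_half_lt_one (by exact_mod_cast hγ)
  have h_const : A * (1 + 2 / (1 - (2⁻¹ : ℝ≥0∞) ^ (γ : ℝ))) ≠ ∞ :=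
    ENNReal.mul_ne_top hA <| ENNReal.add_ne_top.2
      ⟨ENNReal.one_ne_top, ENNReal.div_ne_top ENNReal.ofNat_ne_top (tsub_pos_of_lt hρ).ne'⟩
  refine ⟨_, holderWith_of_edist_le_pow
    (c := (A * (1 + 2 / (1 - (2⁻¹ : ℝ≥0∞) ^ (γ : ℝ)))).toNNReal) edist_unitInterval_le_one
    fun n y w hyw => ?_⟩
  rw [ENNReal.coe_toNNReal h_const]
  exact hf.edist_lim_le hρ hg hyw

end DyadicChaining

section KolmogorovChentsov

variable {Ω : Type*} [MeasurableSpace Ω] {P : Measure Ω}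

theorem ae_tsum_ne_top {ι : Type*} [Countable ι] {f : ι → Ω → ℝ≥0∞} (hf : ∀ i, Measurable (f i))
    (h_sum : ∑' i, ∫⁻ ω, f i ω ∂P ≠ ∞) : ∀ᵐ ω ∂P, ∑' i, f i ω ≠ ∞ := by
  rw [← lintegral_tsum fun i => (hf i).aemeasurable] at h_sum
  filter_upwards [ae_lt_top (Measurable.tsum hf) h_sum] with ω hω using hω.ne

theorem isKolmogorovProcess_comp_of_lipschitzWith {S T E : Type*} [PseudoEMetricSpace S]
    [PseudoEMetricSpace T] [PseudoEMetricSpace E] {X : T → Ω → E} {p q : ℝ} {M K : ℝ≥0}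
    (hX : IsKolmogorovProcess X P p q M) {φ : S → T} (hφ : LipschitzWith K φ) :
    IsKolmogorovProcess (fun s => X (φ s)) P p q (M * K ^ q) where
  measurablePair s t := hX.measurablePair (φ s) (φ t)
  kolmogorovCondition s t := by
    calc ∫⁻ ω, edist (X (φ s) ω) (X (φ t) ω) ^ p ∂P
        ≤ M * edist (φ s) (φ t) ^ q := hX.kolmogorovCondition _ _
      _ ≤ M * (K * edist s t) ^ q := by
        gcongr
        exacts [hX.q_pos.le, hφ s t]
      _ = (M * K ^ q : ℝ≥0) * edist s t ^ q := by
        rw [ENNReal.mul_rpow_of_nonneg _ _ hX.q_pos.le, ENNReal.coe_mul,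
          ENNReal.coe_rpow_of_nonneg _ hX.q_pos.le, mul_assoc]
  p_pos := hX.p_pos
  q_pos := hX.q_pos

variable {E : Type*} {p q : ℝ} {M : ℝ≥0}

theorem lintegral_edist_rpow_le_of_edist_le [PseudoEMetricSpace E] {X : unitInterval → Ω → E}
    (hX : IsKolmogorovProcess X P p q M) {n : ℕ} {y w : unitInterval} (hyw : edist y w ≤ 2⁻¹ ^ n) :
    ∫⁻ ω, edist (X y ω) (X w ω) ^ p ∂P ≤ M * ((2⁻¹ : ℝ≥0∞) ^ q) ^ n := by
  refine (hX.kolmogorovCondition y w).trans ?_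
  rw [← ENNReal.rpow_mul_natCast, mul_comm q, ENNReal.rpow_natCast_mul]
  gcongr
  exact hX.q_pos.le

/-- The increment of `f` over the `i.2`-th dyadic interval of level `i.1`, in units of
`ρ ^ i.1`. -/
noncomputable def scaledDyadicIncrement [PseudoEMetricSpace E] (f : unitInterval → E) (ρ : ℝ≥0∞)
    (i : Σ n : ℕ, Fin (2 ^ n)) : ℝ≥0∞ :=
  edist (f (dyadicPoint i.1 i.2)) (f (dyadicPoint i.1 (i.2 + 1))) / ρ ^ i.1

theorem hasDyadicIncrementBound_tsum [PseudoEMetricSpace E] (f : unitInterval → E) {ρ : ℝ≥0∞}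
    (hρ_zero : ρ ≠ 0) (hρ_top : ρ ≠ ∞) (hp : 0 < p) :
    HasDyadicIncrementBound f ((∑' i, scaledDyadicIncrement f ρ i ^ p) ^ p⁻¹) ρ := by
  intro n k
  rcases lt_or_ge k (2 ^ n) with hk | hk
  · rw [← ENNReal.div_le_iff (pow_ne_zero n hρ_zero) (ENNReal.pow_ne_top hρ_top),
      ENNReal.le_rpow_inv_iff hp]
    exact ENNReal.le_tsum (f := fun i => scaledDyadicIncrement f ρ i ^ p) ⟨n, k, hk⟩
  · rw [dyadicPoint_of_two_pow_le hk, dyadicPoint_of_two_pow_le (hk.trans k.le_succ), edist_self]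
    exact zero_le

theorem lintegral_scaledDyadicIncrement_le [PseudoEMetricSpace E] {X : unitInterval → Ω → E}
    (hX : IsKolmogorovProcess X P p q M) (ρ : ℝ≥0∞) (i : Σ n : ℕ, Fin (2 ^ n)) :
    ∫⁻ ω, scaledDyadicIncrement (X · ω) ρ i ^ p ∂P ≤ M * (2⁻¹ ^ q / ρ ^ p) ^ i.1 := by
  have h_pow : (ρ ^ i.1) ^ p = (ρ ^ p) ^ i.1 := by
    rw [← ENNReal.rpow_mul_natCast, mul_comm p, ENNReal.rpow_natCast_mul]
  simp only [scaledDyadicIncrement, ENNReal.div_rpow_of_nonneg _ _ hX.p_pos.le, h_pow]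
  simp only [div_eq_mul_inv, mul_pow, ENNReal.inv_pow, ← mul_assoc]
  rw [lintegral_mul_const _ (hX.measurable_edist.pow_const p)]
  gcongr
  exact lintegral_edist_rpow_le_of_edist_le hX (edist_dyadicPoint_succ_le _ _)

theorem tsum_lintegral_scaledDyadicIncrement_ne_top [PseudoEMetricSpace E]
    {X : unitInterval → Ω → E} (hX : IsKolmogorovProcess X P p q M) {ρ : ℝ≥0∞}
    (hqρ : 2 * 2⁻¹ ^ q < ρ ^ p) :
    ∑' i, ∫⁻ ω, scaledDyadicIncrement (X · ω) ρ i ^ p ∂P ≠ ∞ := by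
  have h_level (n : ℕ) : ∑' k : Fin (2 ^ n), ∫⁻ ω, scaledDyadicIncrement (X · ω) ρ ⟨n, k⟩ ^ p ∂P
      ≤ M * (2 * 2⁻¹ ^ q / ρ ^ p) ^ n := by
    refine (ENNReal.tsum_le_tsum fun k =>
      lintegral_scaledDyadicIncrement_le hX ρ ⟨n, k⟩).trans_eq ?_
    simp only [tsum_fintype, Finset.sum_const, Finset.card_univ, Fintype.card_fin, nsmul_eq_mul]
    rw [mul_div_assoc, mul_pow, Nat.cast_pow, Nat.cast_ofNat, mul_left_comm]
  have h_ratio : 2 * 2⁻¹ ^ q / ρ ^ p < 1 := ENNReal.div_lt_of_lt_mul (by rwa [one_mul])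
  rw [ENNReal.tsum_sigma']
  refine ne_top_of_le_ne_top ?_ (ENNReal.tsum_le_tsum h_level)
  rw [ENNReal.tsum_mul_left]
  exact ENNReal.mul_ne_top ENNReal.coe_ne_top (tsum_geometric_lt_top.2 h_ratio).ne

theorem ae_exists_hasDyadicIncrementBound [PseudoEMetricSpace E] {X : unitInterval → Ω → E}
    (hX : IsKolmogorovProcess X P p q M) {ρ : ℝ≥0∞} (hρ : ρ ≠ ∞) (hqρ : 2 * 2⁻¹ ^ q < ρ ^ p) :
    ∀ᵐ ω ∂P, ∃ A ≠ ∞, HasDyadicIncrementBound (X · ω) A ρ := by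
  have hρ_zero : ρ ≠ 0 := by
    rintro rfl
    simp [ENNReal.zero_rpow_of_pos hX.p_pos] at hqρ
  have h_meas (i : Σ n : ℕ, Fin (2 ^ n)) :
      Measurable fun ω => scaledDyadicIncrement (X · ω) ρ i ^ p :=
    (hX.measurable_edist.div_const _).pow_const p
  filter_upwards [ae_tsum_ne_top h_meas (tsum_lintegral_scaledDyadicIncrement_ne_top hX hqρ)]
    with ω hω
  exact ⟨_, ENNReal.rpow_ne_top_of_nonneg (inv_nonneg.2 hX.p_pos.le) hω,
    hasDyadicIncrementBound_tsum (X · ω) hρ_zero hρ hX.p_pos⟩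

theorem ae_tendsto_dyadicFloor [PseudoEMetricSpace E] {X : unitInterval → Ω → E}
    (hX : IsKolmogorovProcess X P p q M) (y : unitInterval) :
    ∀ᵐ ω ∂P, Tendsto (fun n => X (dyadicFloor n y) ω) atTop (𝓝 (X y ω)) := by
  have h_meas (n : ℕ) : Measurable fun ω => edist (X (dyadicFloor n y) ω) (X y ω) ^ p :=
    hX.measurable_edist.pow_const p
  have h_sum : ∑' n, ∫⁻ ω, edist (X (dyadicFloor n y) ω) (X y ω) ^ p ∂P ≠ ∞ := by
    refine ne_top_of_le_ne_top ?_ (ENNReal.tsum_le_tsum fun n =>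
      lintegral_edist_rpow_le_of_edist_le hX (edist_dyadicFloor_le n y))
    rw [ENNReal.tsum_mul_left]
    exact ENNReal.mul_ne_top ENNReal.coe_ne_top
      (tsum_geometric_lt_top.2 (ENNReal.rpow_lt_one ENNReal.one_half_lt_one hX.q_pos)).ne
  filter_upwards [ae_tsum_ne_top h_meas h_sum] with ω hω
  rw [tendsto_iff_edist_tendsto_0]
  have h_root := (ENNReal.tendsto_atTop_zero_of_tsum_ne_top hω).ennrpow_const p⁻¹
  simpa only [ENNReal.rpow_rpow_inv hX.p_pos.ne', ENNReal.zero_rpow_of_pos (inv_pos.2 hX.p_pos)]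
    using h_root

theorem two_mul_two_inv_rpow_lt {γ : ℝ≥0} (hp : 0 < p) (hγ : (γ : ℝ) < (q - 1) / p) :
    2 * (2⁻¹ : ℝ≥0∞) ^ q < (2⁻¹ ^ (γ : ℝ)) ^ p := by
  have h_exp : 1 - q < -(γ * p) := by linarith [(lt_div_iff₀ hp).1 hγ]
  have h_two : (2 : ℝ≥0∞) * 2⁻¹ ^ q = 2 ^ (1 - q) := by
    rw [ENNReal.rpow_sub _ _ two_ne_zero ENNReal.ofNat_ne_top, ENNReal.rpow_one,
      ENNReal.inv_rpow, div_eq_mul_inv]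
  rw [h_two, ← ENNReal.rpow_mul, ENNReal.inv_rpow, ← ENNReal.rpow_neg]
  exact ENNReal.rpow_lt_rpow_of_exponent_lt ENNReal.one_lt_two ENNReal.ofNat_ne_top h_exp

theorem exists_holder_modification_unitInterval [EMetricSpace E] [CompleteSpace E]
    [MeasurableSpace E] [BorelSpace E] {X : unitInterval → Ω → E}
    (hX : IsKolmogorovProcess X P p q M) (hq : 1 < q) :
    ∃ Y : unitInterval → Ω → E, (∀ y, Measurable (Y y)) ∧ (∀ y, Y y =ᵐ[P] X y) ∧
      ∀ γ : ℝ≥0, (γ : ℝ) < (q - 1) / p → ∀ ω, ∃ C, HolderWith C γ (Y · ω) := by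
  classical
  obtain ⟨γ, -, hγ_mem, hγ_tendsto⟩ := exists_seq_strictMono_tendsto'
    (Real.toNNReal_pos.2 (div_pos (sub_pos.2 hq) hX.p_pos))
  have h_good : ∀ᵐ ω ∂P, ∀ m, ∃ A ≠ ∞, HasDyadicIncrementBound (X · ω) A (2⁻¹ ^ (γ m : ℝ)) :=
    ae_all_iff.2 fun m => ae_exists_hasDyadicIncrementBound hX
      (ENNReal.rpow_ne_top_of_nonneg (γ m).coe_nonneg (by simp))
      (two_mul_two_inv_rpow_lt hX.p_pos (Real.lt_toNNReal_iff_coe_lt.1 (hγ_mem m).2))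
  obtain ⟨G, hG_ae, hG_meas, hG⟩ := h_good.exists_measurable_mem
  -- Outside the good set `G` the path is replaced by a constant one, so that every path is good.
  let X' (y : unitInterval) (ω : Ω) : E := if ω ∈ G then X y ω else X 0 ω
  have hX'_bound (ω : Ω) (m : ℕ) :
      ∃ A ≠ ∞, HasDyadicIncrementBound (X' · ω) A (2⁻¹ ^ (γ m : ℝ)) := by
    by_cases hω : ω ∈ G
    · simpa only [X', if_pos hω] using hG ω hω m
    · exact ⟨0, ENNReal.zero_ne_top, fun n k => by simp only [X', if_neg hω, edist_self, zero_le]⟩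
  have hX'_lim (y : unitInterval) (ω : Ω) :
      ∃ e, Tendsto (fun n => X' (dyadicFloor n y) ω) atTop (𝓝 e) := by
    obtain ⟨A, hA, h_bound⟩ := hX'_bound ω 0
    exact h_bound.exists_tendsto_dyadicFloor hA
      (ENNReal.rpow_lt_one ENNReal.one_half_lt_one (hγ_mem 0).1) y
  choose Y hY using hX'_lim
  refine ⟨Y, fun y => ?_, fun y => ?_, fun δ hδ ω => ?_⟩
  · exact measurable_of_tendsto_metrizable
      (fun n => (hX.measurable (dyadicFloor n y)).ite hG_meas (hX.measurable 0))
      (tendsto_pi_nhds.2 (hY y))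
  · filter_upwards [hG_ae, ae_tendsto_dyadicFloor hX y] with ω hω h_lim
    exact tendsto_nhds_unique ((hY y ω).congr fun n => if_pos hω) h_lim
  · obtain ⟨m, hm⟩ := (hγ_tendsto.eventually_const_lt (Real.lt_toNNReal_iff_coe_lt.2 hδ)).exists
    obtain ⟨A, hA, h_bound⟩ := hX'_bound ω m
    obtain ⟨C, hC⟩ := h_bound.exists_holderWith_lim hA (hγ_mem m).1 (hY · ω)
    exact ⟨_, hC.of_le (D := 1) edist_unitInterval_le_one hm.le⟩

theorem exists_lipschitzWith_retraction_Icc {a b : ℝ} (hab : a ≤ b) :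
    ∃ (K K' : ℝ≥0) (φ : unitInterval → Set.Icc a b) (ψ : Set.Icc a b → unitInterval),
      LipschitzWith K φ ∧ LipschitzWith K' ψ ∧ Function.LeftInverse φ ψ := by
  have h_pos : 0 < b - a + 1 := by linarith
  have hφ : LipschitzWith (b - a + 1).toNNReal fun s : unitInterval => a + (b - a + 1) * (s : ℝ) :=
    LipschitzWith.of_dist_le' fun s s' => by
      rw [dist_add_left, Real.dist_eq, ← mul_sub, abs_mul, abs_of_pos h_pos]
      rfl
  have hψ : LipschitzWith (b - a + 1)⁻¹.toNNReal fun σ : Set.Icc a b => (σ - a) / (b - a + 1) :=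
    LipschitzWith.of_dist_le' fun σ σ' => by
      rw [Real.dist_eq, ← sub_div, sub_sub_sub_cancel_right, abs_div, abs_of_pos h_pos,
        div_eq_inv_mul]
      rfl
  refine ⟨_, _, _, _, (LipschitzWith.projIcc hab).comp hφ,
    (LipschitzWith.projIcc (zero_le_one' ℝ)).comp hψ, fun σ => ?_⟩
  have h_mem : ((σ : ℝ) - a) / (b - a + 1) ∈ Set.Icc (0 : ℝ) 1 :=
    ⟨div_nonneg (by linarith [σ.2.1]) h_pos.le, (div_le_one h_pos).2 (by linarith [σ.2.2])⟩
  rw [Function.comp_apply, Function.comp_apply, Set.projIcc_of_mem zero_le_one h_mem,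
    mul_div_cancel₀ _ h_pos.ne', add_sub_cancel, Set.projIcc_val]

theorem exists_holder_modification_Icc [EMetricSpace E] [CompleteSpace E]
    [MeasurableSpace E] [BorelSpace E] {a b : ℝ} (hab : a ≤ b) {X : Set.Icc a b → Ω → E}
    (hX : IsKolmogorovProcess X P p q M) (hq : 1 < q) :
    ∃ Y : Set.Icc a b → Ω → E, (∀ y, Measurable (Y y)) ∧ (∀ y, Y y =ᵐ[P] X y) ∧
      ∀ γ : ℝ≥0, (γ : ℝ) < (q - 1) / p → ∀ ω, ∃ C, HolderWith C γ (Y · ω) := by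
  obtain ⟨K, K', φ, ψ, hφ, hψ, h_inv⟩ := exists_lipschitzWith_retraction_Icc hab
  obtain ⟨Y, hY_meas, hY_ae, hY_holder⟩ :=
    exists_holder_modification_unitInterval (isKolmogorovProcess_comp_of_lipschitzWith hX hφ) hq
  refine ⟨fun σ => Y (ψ σ), fun σ => hY_meas _, fun σ => ?_, fun γ hγ ω => ?_⟩
  · simpa only [h_inv σ] using hY_ae (ψ σ)
  · obtain ⟨C, hC⟩ := hY_holder γ hγ ω
    have h_comp := hC.comp hψ.holderWith
    rw [mul_one] at h_comp
    exact ⟨_, h_comp⟩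

end KolmogorovChentsov

section BrownianIncrements

variable {Ω : Type*} [mΩ : MeasurableSpace Ω] {P : Measure Ω} {ℱ : Filtration ℝ≥0 mΩ}
  {W : ℝ≥0 → Ω → ℝ} {f g : Ω → ℝ} {s s' r r' t : ℝ≥0}

namespace IsBrownianMotion

theorem integral_increment (hW : IsBrownianMotion W ℱ P) (s t : ℝ≥0) :
    ∫ ω, (W t ω - W s ω) ∂P = 0 := by
  rw [integral_sub (hW.isBrownianReal.integrable_eval t) (hW.isBrownianReal.integrable_eval s),
    hW.isBrownianReal.integral_eval, hW.isBrownianReal.integral_eval, sub_zero]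

theorem memLp_increment (hW : IsBrownianMotion W ℱ P) (s t : ℝ≥0) :
    MemLp (fun ω => W t ω - W s ω) 2 P :=
  (hW.isBrownianReal.isGaussianProcess.hasGaussianLaw_eval _).memLp_two.sub
    (hW.isBrownianReal.isGaussianProcess.hasGaussianLaw_eval _).memLp_two

theorem integral_increment_sq [IsProbabilityMeasure P] (hW : IsBrownianMotion W ℱ P)
    (hst : s ≤ t) : ∫ ω, (W t ω - W s ω) ^ 2 ∂P = t - s := by
  have hvar : Var[fun ω => W t ω - W s ω; P] = dist (t : ℝ) s :=
    (hW.isBrownianReal.hasLaw_sub t s).variance_eq.trans variance_id_gaussianReal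
  rw [variance_eq_sub (hW.memLp_increment s t), hW.integral_increment s t, Real.dist_eq,
    abs_of_nonneg (sub_nonneg.2 (NNReal.coe_le_coe.2 hst))] at hvar
  simpa using hvar

theorem indepFun_increment (hW : IsBrownianMotion W ℱ P) (hst : s ≤ t)
    (hf : StronglyMeasurable[ℱ s] f) : IndepFun f (fun ω => W t ω - W s ω) P := by
  rw [IndepFun_iff_Indep]
  exact (indep_of_indep_of_le_right (hW.indep_increment s t hst) hf.measurable.comap_le).symm

theorem integral_mul_increment (hW : IsBrownianMotion W ℱ P) (hst : s ≤ t)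
    (hf : StronglyMeasurable[ℱ s] f) : ∫ ω, f ω * (W t ω - W s ω) ∂P = 0 := by
  rw [(hW.indepFun_increment hst hf).integral_fun_mul_eq_mul_integral
    (hf.mono (ℱ.le s)).aestronglyMeasurable (hW.memLp_increment s t).1,
    hW.integral_increment, mul_zero]

theorem integral_mul_increment_sq [IsProbabilityMeasure P] (hW : IsBrownianMotion W ℱ P)
    (hst : s ≤ t) (hf : StronglyMeasurable[ℱ s] f) :
    ∫ ω, f ω * (W t ω - W s ω) ^ 2 ∂P = (t - s) * ∫ ω, f ω ∂P := by
  have hindep : IndepFun f (fun ω => (W t ω - W s ω) ^ 2) P :=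
    (hW.indepFun_increment hst hf).comp measurable_id (measurable_id.pow_const 2)
  rw [hindep.integral_fun_mul_eq_mul_integral (hf.mono (ℱ.le s)).aestronglyMeasurable
    ((hW.memLp_increment s t).1.pow 2), hW.integral_increment_sq hst, mul_comm]

theorem memLp_mul_increment (hW : IsBrownianMotion W ℱ P) (hst : s ≤ t)
    (hf : StronglyMeasurable[ℱ s] f) (hf2 : MemLp f 2 P) :
    MemLp (fun ω => f ω * (W t ω - W s ω)) 2 P := by
  have hD := hW.memLp_increment s t
  have hindep : IndepFun (fun ω => f ω ^ 2) (fun ω => (W t ω - W s ω) ^ 2) P :=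
    (hW.indepFun_increment hst hf).comp (measurable_id.pow_const 2) (measurable_id.pow_const 2)
  refine (memLp_two_iff_integrable_sq (hf2.1.mul hD.1)).2 ?_
  simpa only [Pi.mul_def, mul_pow] using hindep.integrable_mul hf2.integrable_sq hD.integrable_sq

theorem integral_mul_increment_mul_increment_eq_zero (hW : IsBrownianMotion W ℱ P)
    (hs : s ≤ s') (hsr : s' ≤ r) (hr : r ≤ r')
    (hf : StronglyMeasurable[ℱ s] f) (hg : StronglyMeasurable[ℱ r] g) :
    ∫ ω, (f ω * (W s' ω - W s ω)) * (g ω * (W r' ω - W r ω)) ∂P = 0 := by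
  have hmeas : StronglyMeasurable[ℱ r] fun ω => f ω * (W s' ω - W s ω) * g ω :=
    ((hf.mono (ℱ.mono (hs.trans hsr))).mul
      (((hW.adapted s').mono (ℱ.mono hsr)).sub
        ((hW.adapted s).mono (ℱ.mono (hs.trans hsr))))).mul hg
  simpa only [mul_assoc] using hW.integral_mul_increment hr hmeas

theorem integral_mul_increment_mul_increment_of_common_left [IsProbabilityMeasure P]
    (hW : IsBrownianMotion W ℱ P) (hs : r ≤ s') (hr : s' ≤ r')
    (hf : StronglyMeasurable[ℱ r] f) (hf2 : MemLp f 2 P)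
    (hg : StronglyMeasurable[ℱ r] g) (hg2 : MemLp g 2 P) :
    ∫ ω, (f ω * (W s' ω - W r ω)) * (g ω * (W r' ω - W r ω)) ∂P =
      (s' - r) * ∫ ω, f ω * g ω ∂P := by
  have hgs : StronglyMeasurable[ℱ s'] g := hg.mono (ℱ.mono hs)
  have hfW := hW.memLp_mul_increment hs hf hf2
  calc ∫ ω, (f ω * (W s' ω - W r ω)) * (g ω * (W r' ω - W r ω)) ∂P
      = ∫ ω, ((f ω * (W s' ω - W r ω)) * (g ω * (W s' ω - W r ω)) +
          (f ω * (W s' ω - W r ω)) * (g ω * (W r' ω - W s' ω))) ∂P := by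
        congr with ω; ring
    _ = ∫ ω, (f ω * (W s' ω - W r ω)) * (g ω * (W s' ω - W r ω)) ∂P +
          ∫ ω, (f ω * (W s' ω - W r ω)) * (g ω * (W r' ω - W s' ω)) ∂P :=
        integral_add (hfW.integrable_mul (hW.memLp_mul_increment hs hg hg2))
          (hfW.integrable_mul (hW.memLp_mul_increment hr hgs hg2))
    _ = ∫ ω, (f ω * g ω) * (W s' ω - W r ω) ^ 2 ∂P := by
        rw [hW.integral_mul_increment_mul_increment_eq_zero hs le_rfl hr hf hgs, add_zero]
        congr with ω; ring
    _ = (s' - r) * ∫ ω, f ω * g ω ∂P := hW.integral_mul_increment_sq hs (hf.mul hg)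

theorem integral_mul_increment_mul_increment_of_le [IsProbabilityMeasure P]
    (hW : IsBrownianMotion W ℱ P) (hs : s ≤ s') (hsr : s ≤ r) (hr : r ≤ r')
    (hf : StronglyMeasurable[ℱ s] f) (hf2 : MemLp f 2 P)
    (hg : StronglyMeasurable[ℱ r] g) (hg2 : MemLp g 2 P) :
    ∫ ω, (f ω * (W s' ω - W s ω)) * (g ω * (W r' ω - W r ω)) ∂P =
      (min s' r' - r : ℝ≥0) * ∫ ω, f ω * g ω ∂P := by
  rcases le_total s' r with h | h
  · rw [tsub_eq_zero_of_le ((min_le_left _ _).trans h), NNReal.coe_zero, zero_mul,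
      hW.integral_mul_increment_mul_increment_eq_zero hs h hr hf hg]
  have hfr : StronglyMeasurable[ℱ r] f := hf.mono (ℱ.mono hsr)
  have hgW := hW.memLp_mul_increment hr hg hg2
  have hcommon : ∫ ω, (f ω * (W s' ω - W r ω)) * (g ω * (W r' ω - W r ω)) ∂P =
      (min s' r' - r : ℝ≥0) * ∫ ω, f ω * g ω ∂P := by
    rw [NNReal.coe_sub (le_min h hr)]
    rcases le_total s' r' with h' | h'
    · rw [min_eq_left h',
        hW.integral_mul_increment_mul_increment_of_common_left h h' hfr hf2 hg hg2]
    · simp only [min_eq_right h', mul_comm (f _ * (_ - _)), mul_comm (f _) (g _),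
        hW.integral_mul_increment_mul_increment_of_common_left hr h' hg hg2 hfr hf2]
  calc ∫ ω, (f ω * (W s' ω - W s ω)) * (g ω * (W r' ω - W r ω)) ∂P
      = ∫ ω, ((f ω * (W r ω - W s ω)) * (g ω * (W r' ω - W r ω)) +
          (f ω * (W s' ω - W r ω)) * (g ω * (W r' ω - W r ω))) ∂P := by
        congr with ω; ring
    _ = ∫ ω, (f ω * (W r ω - W s ω)) * (g ω * (W r' ω - W r ω)) ∂P +
          ∫ ω, (f ω * (W s' ω - W r ω)) * (g ω * (W r' ω - W r ω)) ∂P :=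
        integral_add ((hW.memLp_mul_increment hsr hf hf2).integrable_mul hgW)
          ((hW.memLp_mul_increment h hfr hf2).integrable_mul hgW)
    _ = (min s' r' - r : ℝ≥0) * ∫ ω, f ω * g ω ∂P := by
        rw [hW.integral_mul_increment_mul_increment_eq_zero hsr le_rfl hr hf hg, zero_add, hcommon]

/-- The subtraction in `ℝ≥0` is truncated, so the factor is the length of the overlap of the two
time intervals. -/
theorem integral_mul_increment_mul_increment [IsProbabilityMeasure P]
    (hW : IsBrownianMotion W ℱ P) (hs : s ≤ s') (hr : r ≤ r')
    (hf : StronglyMeasurable[ℱ s] f) (hf2 : MemLp f 2 P)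
    (hg : StronglyMeasurable[ℱ r] g) (hg2 : MemLp g 2 P) :
    ∫ ω, (f ω * (W s' ω - W s ω)) * (g ω * (W r' ω - W r ω)) ∂P =
      (min s' r' - max s r : ℝ≥0) * ∫ ω, f ω * g ω ∂P := by
  rcases le_total s r with h | h
  · rw [max_eq_right h, hW.integral_mul_increment_mul_increment_of_le hs h hr hf hf2 hg hg2]
  · simp only [max_eq_left h, min_comm s', mul_comm (f _ * (_ - _)), mul_comm (f _) (g _),
      hW.integral_mul_increment_mul_increment_of_le hr h hs hg hg2 hf hf2]

theorem integral_mul_stopped_increment_mul_stopped_increment [IsProbabilityMeasure P]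
    (hW : IsBrownianMotion W ℱ P) (t : ℝ≥0) (hs : s ≤ s') (hr : r ≤ r')
    (hf : StronglyMeasurable[ℱ s] f) (hf2 : MemLp f 2 P)
    (hg : StronglyMeasurable[ℱ r] g) (hg2 : MemLp g 2 P) :
    ∫ ω, (f ω * (W (min s' t) ω - W (min s t) ω)) *
        (g ω * (W (min r' t) ω - W (min r t) ω)) ∂P =
      (min (min s' r') t - max s r : ℝ≥0) * ∫ ω, f ω * g ω ∂P := by
  rcases le_total t (max s r) with h | h
  · rw [tsub_eq_zero_of_le ((min_le_right _ _).trans h)]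
    rcases le_max_iff.1 h with h | h
    · simp [min_eq_right h, min_eq_right (h.trans hs)]
    · simp [min_eq_right h, min_eq_right (h.trans hr)]
  · obtain ⟨hst, hrt⟩ := max_le_iff.1 h
    rw [min_eq_left hst, min_eq_left hrt, inf_inf_distrib_right,
      hW.integral_mul_increment_mul_increment (le_min hs hst) (le_min hr hrt) hf hf2 hg hg2]

theorem memLp_mul_stopped_increment (hW : IsBrownianMotion W ℱ P) (t : ℝ≥0) (hs : s ≤ s')
    (hf : StronglyMeasurable[ℱ s] f) (hf2 : MemLp f 2 P) :
    MemLp (fun ω => f ω * (W (min s' t) ω - W (min s t) ω)) 2 P := by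
  rcases le_total t s with h | h
  · simp [min_eq_right h, min_eq_right (h.trans hs)]
  · rw [min_eq_left h]
    exact hW.memLp_mul_increment (le_min hs h) hf hf2

end IsBrownianMotion

end BrownianIncrements

section InnerProducts

variable {S K : Type*} [MeasurableSpace S] [MetricSpace K] [CompactSpace K] {μ : Measure S}

theorem coeFn_toField {f : S → C(K, ℝ)} (hf : MemLp f 2 μ) (k : K) :
    toField f hf k =ᵐ[μ] fun s => f s k :=
  (memLp_eval hf k).coeFn_toLp

theorem inner_toField_toField {f g : S → C(K, ℝ)} (hf : MemLp f 2 μ) (hg : MemLp g 2 μ)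
    (k l : K) : inner ℝ (toField f hf k) (toField g hg l) = ∫ s, f s k * g s l ∂μ := by
  rw [L2.inner_def]
  refine integral_congr_ae ?_
  filter_upwards [coeFn_toField hf k, coeFn_toField hg l] with s hfs hgs
  simp [hfs, hgs, mul_comm]

theorem integral_sum_mul_sum {ι κ : Type*} {f : ι → S → ℝ} {g : κ → S → ℝ} (I : Finset ι)
    (J : Finset κ) (hf : ∀ i ∈ I, MemLp (f i) 2 μ) (hg : ∀ j ∈ J, MemLp (g j) 2 μ) :
    ∫ s, (∑ i ∈ I, f i s) * (∑ j ∈ J, g j s) ∂μ = ∑ i ∈ I, ∑ j ∈ J, ∫ s, f i s * g j s ∂μ := by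
  have hint : ∀ i ∈ I, ∀ j ∈ J, Integrable (fun s => f i s * g j s) μ := fun i hi j hj =>
    (hf i hi).integrable_mul (hg j hj)
  simp_rw [Finset.sum_mul_sum]
  rw [integral_finsetSum I fun i hi => integrable_finsetSum J (hint i hi)]
  exact Finset.sum_congr rfl fun i hi => integral_finsetSum J (hint i hi)

end InnerProducts

section TimeRestriction

variable {Ω : Type*} [MeasurableSpace Ω] {P : Measure Ω} {t T : ℝ≥0}

theorem timeProd_mono [SFinite P] (htT : t ≤ T) : timeProd t P ≤ timeProd T P :=
  Measure.prod_mono (Measure.restrict_mono_set _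
    (Set.Icc_subset_Icc_right (NNReal.coe_le_coe.2 htT))) le_rfl

theorem integral_indicator_mul_indicator_timeProd [SFinite P] (s s' r r' : ℝ≥0) (f g : Ω → ℝ) :
    ∫ p : ℝ × Ω, (Set.Ico (s : ℝ) s').indicator (fun _ => f p.2) p.1 *
        (Set.Ico (r : ℝ) r').indicator (fun _ => g p.2) p.1 ∂timeProd t P =
      (min (min s' r') t - max s r : ℝ≥0) * ∫ ω, f ω * g ω ∂P := by
  have hprod : ∀ p : ℝ × Ω, (Set.Ico (s : ℝ) s').indicator (fun _ => f p.2) p.1 *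
        (Set.Ico (r : ℝ) r').indicator (fun _ => g p.2) p.1 =
      (Set.Ico (max s r : ℝ) (min s' r')).indicator 1 p.1 * (f p.2 * g p.2) := fun p => by
    rw [← Set.inter_indicator_mul, Set.Ico_inter_Ico]
    by_cases hp : p.1 ∈ Set.Ico (max s r : ℝ) (min s' r') <;> simp [hp]
  have hlength : (volume.restrict (Set.Icc 0 (t : ℝ))).real (Set.Ico (max s r : ℝ) (min s' r')) =
      (min (min s' r') t - max s r : ℝ≥0) := by
    rw [← Measure.restrict_congr_set Ico_ae_eq_Icc, measureReal_restrict_apply measurableSet_Ico,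
      Set.Ico_inter_Ico, Real.volume_real_Ico,
      max_eq_left (le_max_of_le_left s.coe_nonneg), NNReal.coe_sub_def, NNReal.coe_min,
      NNReal.coe_min, NNReal.coe_max]
  simp_rw [hprod]
  rw [timeProd, integral_prod_mul (fun x : ℝ => _) (fun ω => f ω * g ω),
    integral_indicator_one measurableSet_Ico, hlength]

/-- The restriction map from `L²([0,T] × Ω)` to `L²([0,t] × Ω)`. -/
noncomputable def restrictTime (P : Measure Ω) [SFinite P] (htT : t ≤ T) :
    Lp ℝ 2 (timeProd T P) →L[ℝ] Lp ℝ 2 (timeProd t P) :=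
  Lp.LpToLpOfMeasureLeSMul (c := 1) ENNReal.one_ne_top (by simpa using timeProd_mono htT)

variable [SFinite P]

theorem coeFn_restrictTime (htT : t ≤ T) (f : Lp ℝ 2 (timeProd T P)) :
    restrictTime P htT f =ᵐ[timeProd t P] f :=
  Lp.coeFn_LpToLpOfMeasureLeSMul _ _ f

theorem norm_restrictTime_le (htT : t ≤ T) (f : Lp ℝ 2 (timeProd T P)) :
    ‖restrictTime P htT f‖ ≤ ‖f‖ := by
  have hnorm : ‖restrictTime P htT‖ ≤ 1 :=
    (Lp.norm_LpToLpOfMeasureLeSMul_le _ _).trans (by simp)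
  simpa using (restrictTime P htT).le_of_opNorm_le hnorm f

theorem restrictTime_toField {K : Type*} [MetricSpace K] [CompactSpace K] (htT : t ≤ T)
    {f : ℝ × Ω → C(K, ℝ)} (hf : MemLp f 2 (timeProd T P)) (k : K) :
    restrictTime P htT (toField f hf k) = toField f (hf.mono_measure (timeProd_mono htT)) k := by
  have hf' := hf.mono_measure (timeProd_mono htT)
  apply Lp.ext
  calc restrictTime P htT (toField f hf k)
      =ᵐ[timeProd t P] toField f hf k := coeFn_restrictTime htT _
    _ =ᵐ[timeProd t P] fun p => f p k :=
        (timeProd_mono htT).absolutelyContinuous.ae_eq (coeFn_toField hf k)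
    _ =ᵐ[timeProd t P] toField f hf' k := (coeFn_toField hf' k).symm

end TimeRestriction

section ItoIsometry

variable {Ω K : Type*} [mΩ : MeasurableSpace Ω] [MetricSpace K] [CompactSpace K] {P : Measure Ω}
  {ℱ : Filtration ℝ≥0 mΩ} {W : ℝ≥0 → Ω → ℝ} {t T : ℝ≥0}

namespace ElementaryProcess

theorem time_castSucc_le_time_succ (u : ElementaryProcess K ℱ P T) (i : Fin (u.n + 1)) :
    u.time i.castSucc ≤ u.time i.succ :=
  u.time_mono (Fin.castSucc_le_succ i)

theorem stronglyMeasurable_coeff_eval (u : ElementaryProcess K ℱ P T) (i : Fin (u.n + 1)) (k : K) :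
    StronglyMeasurable[ℱ (u.time i.castSucc)] fun ω => u.coeff i ω k :=
  (continuous_eval_const k).comp_stronglyMeasurable (u.coeff_meas i)

theorem toFun_apply (u : ElementaryProcess K ℱ P T) (p : ℝ × Ω) (k : K) :
    u.toFun p k = ∑ i : Fin (u.n + 1),
      (Set.Ico (u.time i.castSucc : ℝ) (u.time i.succ)).indicator
        (fun _ => u.coeff i p.2 k) p.1 := by
  rw [toFun, ContinuousMap.sum_apply]
  refine Finset.sum_congr rfl fun i _ => ?_
  by_cases hp : p.1 ∈ Set.Ico (u.time i.castSucc : ℝ) (u.time i.succ)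
  · rw [Set.indicator_of_mem hp, Set.indicator_of_mem hp]
  · rw [Set.indicator_of_notMem hp, Set.indicator_of_notMem hp, ContinuousMap.zero_apply]

theorem integralFun_apply (u : ElementaryProcess K ℱ P T) (ω : Ω) (k : K) :
    u.integralFun W t ω k = ∑ i : Fin (u.n + 1),
      u.coeff i ω k * (W (min (u.time i.succ) t) ω - W (min (u.time i.castSucc) t) ω) := by
  simp [integralFun, ContinuousMap.sum_apply, mul_comm]

theorem integral_integralFun_mul_integralFun [IsProbabilityMeasure P]
    (hW : IsBrownianMotion W ℱ P) (u v : ElementaryProcess K ℱ P T) (k l : K) :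
    ∫ ω, u.integralFun W t ω k * v.integralFun W t ω l ∂P =
      ∑ i, ∑ j, (min (min (u.time i.succ) (v.time j.succ)) t -
        max (u.time i.castSucc) (v.time j.castSucc) : ℝ≥0) *
          ∫ ω, u.coeff i ω k * v.coeff j ω l ∂P := by
  have hterm : ∀ (w : ElementaryProcess K ℱ P T) (m : K), ∀ i ∈ Finset.univ, MemLp (fun ω =>
      w.coeff i ω m * (W (min (w.time i.succ) t) ω - W (min (w.time i.castSucc) t) ω)) 2 P :=
    fun w m i _ => hW.memLp_mul_stopped_increment t (w.time_castSucc_le_time_succ i)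
      (w.stronglyMeasurable_coeff_eval i m) (memLp_eval (w.coeff_memLp i) m)
  simp_rw [integralFun_apply]
  rw [integral_sum_mul_sum _ _ (hterm u k) (hterm v l)]
  refine Finset.sum_congr rfl fun i _ => Finset.sum_congr rfl fun j _ => ?_
  exact hW.integral_mul_stopped_increment_mul_stopped_increment t
    (u.time_castSucc_le_time_succ i) (v.time_castSucc_le_time_succ j)
    (u.stronglyMeasurable_coeff_eval i k) (memLp_eval (u.coeff_memLp i) k)
    (v.stronglyMeasurable_coeff_eval j l) (memLp_eval (v.coeff_memLp j) l)

theorem integral_toFun_mul_toFun [SFinite P] (u v : ElementaryProcess K ℱ P T) (k l : K) :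
    ∫ p, u.toFun p k * v.toFun p l ∂timeProd t P =
      ∑ i, ∑ j, (min (min (u.time i.succ) (v.time j.succ)) t -
        max (u.time i.castSucc) (v.time j.castSucc) : ℝ≥0) *
          ∫ ω, u.coeff i ω k * v.coeff j ω l ∂P := by
  have hterm : ∀ (w : ElementaryProcess K ℱ P T) (m : K), ∀ i ∈ Finset.univ,
      MemLp (fun p : ℝ × Ω => (Set.Ico (w.time i.castSucc : ℝ) (w.time i.succ)).indicator
        (fun _ => w.coeff i p.2 m) p.1) 2 (timeProd t P) := fun w m i _ =>
    MemLp.indicator (measurable_fst measurableSet_Ico)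
      ((memLp_eval (w.coeff_memLp i) m).comp_snd (volume.restrict (Set.Icc 0 (t : ℝ))))
  simp_rw [toFun_apply]
  rw [integral_sum_mul_sum _ _ (hterm u k) (hterm v l)]
  refine Finset.sum_congr rfl fun i _ => Finset.sum_congr rfl fun j _ => ?_
  exact integral_indicator_mul_indicator_timeProd _ _ _ _
    (fun ω => u.coeff i ω k) (fun ω => v.coeff j ω l)

variable [IsProbabilityMeasure P]

theorem inner_integral_integral (hW : IsBrownianMotion W ℱ P) (u v : ElementaryProcess K ℱ P T)
    (htT : t ≤ T) (k l : K) :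
    inner ℝ (u.integral hW t k) (v.integral hW t l) =
      inner ℝ (restrictTime P htT (u.field k)) (restrictTime P htT (v.field l)) := by
  simp only [field, integral, restrictTime_toField, inner_toField_toField,
    integral_integralFun_mul_integralFun hW, integral_toFun_mul_toFun]

theorem norm_integral_sub_integral (hW : IsBrownianMotion W ℱ P)
    (u v : ElementaryProcess K ℱ P T) (htT : t ≤ T) (k l : K) :
    ‖u.integral hW t k - v.integral hW t l‖ = ‖restrictTime P htT (u.field k - v.field l)‖ := by
  rw [map_sub, ← sq_eq_sq₀ (norm_nonneg _) (norm_nonneg _)]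
  simp only [← real_inner_self_eq_norm_sq, inner_sub_left, inner_sub_right,
    inner_integral_integral hW _ _ htT]

theorem dist_integral_le (hW : IsBrownianMotion W ℱ P) (u v : ElementaryProcess K ℱ P T)
    (htT : t ≤ T) : dist (u.integral hW t) (v.integral hW t) ≤ dist u.field v.field := by
  refine (ContinuousMap.dist_le dist_nonneg).2 fun k => ?_
  calc dist (u.integral hW t k) (v.integral hW t k)
      = ‖restrictTime P htT (u.field k - v.field k)‖ := by
        rw [dist_eq_norm, norm_integral_sub_integral hW u v htT]
    _ ≤ ‖u.field k - v.field k‖ := norm_restrictTime_le htT _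
    _ ≤ dist u.field v.field := by
        rw [← dist_eq_norm]; exact ContinuousMap.dist_apply_le_dist k

end ElementaryProcess

end ItoIsometry

section ExtensionByDensity

theorem neBot_comap_nhds_of_mem_closure_range {ι X : Type*} [TopologicalSpace X] {J : ι → X}
    {x : X} (hx : x ∈ closure (Set.range J)) : (comap J (𝓝 x)).NeBot := by
  rw [comap_neBot_iff_frequently]
  simpa only [mem_closure_iff_frequently] using hx

theorem exists_tendsto_of_dist_le {ι X Z : Type*} [PseudoMetricSpace X] [PseudoMetricSpace Z]
    [CompleteSpace Z] {I : ι → Z} {J : ι → X}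
    (hIJ : ∀ i j, dist (I i) (I j) ≤ dist (J i) (J j)) {x : X}
    (hx : x ∈ closure (Set.range J)) : ∃ z, Tendsto I (comap J (𝓝 x)) (𝓝 z) := by
  have := neBot_comap_nhds_of_mem_closure_range hx
  refine cauchy_map_iff_exists_tendsto.1 (cauchy_map_iff'.2 ?_)
  rw [Metric.uniformity_eq_comap_nhds_zero, tendsto_comap_iff]
  have hJ : Tendsto J (comap J (𝓝 x)) (𝓝 x) := tendsto_comap
  have hdist := (hJ.comp tendsto_fst).dist (hJ.comp tendsto_snd)
  rw [dist_self] at hdist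
  exact squeeze_zero (fun _ => dist_nonneg) (fun p => hIJ p.1 p.2) hdist

end ExtensionByDensity

section MomentBound

variable {S : Type*} [MeasurableSpace S] {μ : Measure S}

theorem sq_eLpNorm_two {E : Type*} [NormedAddCommGroup E] (f : S → E) :
    eLpNorm f 2 μ ^ 2 = ∫⁻ s, ‖f s‖ₑ ^ 2 ∂μ := by
  simpa using eLpNorm_nnreal_pow_eq_lintegral (f := f) (μ := μ) (p := 2) two_ne_zero

theorem sq_eLpNorm_two_comp_snd_timeProd [SFinite μ] {L : S → ℝ}
    (hL : AEStronglyMeasurable L μ) (t : ℝ≥0) :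
    eLpNorm (fun p : ℝ × S => L p.2) 2 (timeProd t μ) ^ 2 = t * eLpNorm L 2 μ ^ 2 := by
  rw [sq_eLpNorm_two, sq_eLpNorm_two, timeProd, lintegral_prod _ (hL.comp_snd.enorm.pow_const 2)]
  simp [mul_comm]

theorem sq_enorm_restrictTime_sub_le [SFinite μ] {t T : ℝ≥0} (htT : t ≤ T)
    {f g : Lp ℝ 2 (timeProd T μ)} {L : S → ℝ} (hL : AEStronglyMeasurable L μ) {c : ℝ}
    (hfg : ∀ᵐ p ∂timeProd t μ, |f p - g p| ≤ L p.2 * c) :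
    ‖restrictTime μ htT (f - g)‖ₑ ^ 2 ≤ t * eLpNorm L 2 μ ^ 2 * ‖c‖ₑ ^ 2 := by
  have hfg_norm : ∀ᵐ p ∂timeProd t μ, ‖restrictTime μ htT (f - g) p‖ ≤ ‖c • L p.2‖ := by
    filter_upwards [hfg, coeFn_restrictTime htT (f - g),
      (timeProd_mono htT).absolutelyContinuous.ae_eq (Lp.coeFn_sub f g)] with p hp hrestrict hsub
    rw [hrestrict, hsub, smul_eq_mul, mul_comm]
    exact hp.trans (le_abs_self _)
  calc ‖restrictTime μ htT (f - g)‖ₑ ^ 2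
      ≤ eLpNorm (c • fun p : ℝ × S => L p.2) 2 (timeProd t μ) ^ 2 := by
        rw [Lp.enorm_def]
        gcongr ?_ ^ 2
        exact eLpNorm_mono_ae hfg_norm
    _ = t * eLpNorm L 2 μ ^ 2 * ‖c‖ₑ ^ 2 := by
        rw [eLpNorm_const_smul, mul_pow, sq_eLpNorm_two_comp_snd_timeProd hL, mul_comm]

end MomentBound

section ItoIntegral

variable {Ω K : Type*} [mΩ : MeasurableSpace Ω] [MetricSpace K] [CompactSpace K] {P : Measure Ω}
  {ℱ : Filtration ℝ≥0 mΩ} {W : ℝ≥0 → Ω → ℝ} {t T : ℝ≥0}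

namespace ElementaryProcess

theorem stronglyMeasurable_integralFun (hW : IsBrownianMotion W ℱ P)
    (u : ElementaryProcess K ℱ P T) (t : ℝ≥0) : StronglyMeasurable[ℱ t] (u.integralFun W t) := by
  refine Finset.stronglyMeasurable_fun_sum _ fun i _ => ?_
  rcases le_total t (u.time i.castSucc) with h | h
  · simp only [min_eq_right h, min_eq_right (h.trans (u.time_castSucc_le_time_succ i)), sub_self,
      zero_smul]
    exact stronglyMeasurable_const
  · have hstopped : ∀ r, StronglyMeasurable[ℱ t] (W (min r t)) := fun r =>
      (hW.adapted _).mono (ℱ.mono (min_le_right r t))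
    exact ((hstopped _).sub (hstopped _)).smul ((u.coeff_meas i).mono (ℱ.mono h))

theorem integral_mem_integralSpace (hW : IsBrownianMotion W ℱ P)
    (u : ElementaryProcess K ℱ P T) (t : ℝ≥0) : u.integral hW t ∈ integralSpace K ℱ P t :=
  subset_closure ⟨u.integralFun W t, u.memLp_integralFun hW t,
    u.stronglyMeasurable_integralFun hW t, rfl⟩

end ElementaryProcess

variable [IsProbabilityMeasure P] {hW : IsBrownianMotion W ℱ P}
  {x : C(K, Lp ℝ 2 (timeProd T P))} {z z' : C(K, Lp ℝ 2 P)}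

theorem exists_isItoIntegral (hW : IsBrownianMotion W ℱ P) (htT : t ≤ T)
    (hx : x ∈ integrands K ℱ P T) : ∃ z, IsItoIntegral hW x t z := by
  have := neBot_comap_nhds_of_mem_closure_range hx
  obtain ⟨z, hz⟩ := exists_tendsto_of_dist_le (I := fun u => u.integral hW t)
    (fun u v => u.dist_integral_le hW v htT) hx
  exact ⟨z, hx,
    isClosed_closure.mem_of_tendsto hz (.of_forall fun u => u.integral_mem_integralSpace hW t),
    fun u hu => hz.comp (tendsto_comap_iff.2 hu)⟩

theorem IsItoIntegral.exists_approximation (hz : IsItoIntegral hW x t z) :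
    ∃ u : ℕ → ElementaryProcess K ℱ P T, Tendsto (fun n => (u n).field) atTop (𝓝 x) ∧
      Tendsto (fun n => (u n).integral hW t) atTop (𝓝 z) := by
  obtain ⟨f, hf, hfx⟩ := mem_closure_iff_seq_limit.1 hz.mem_integrands
  choose u hu using hf
  obtain rfl : (fun n => (u n).field) = f := funext hu
  exact ⟨u, hfx, hz.tendsto_integral u hfx⟩

theorem IsItoIntegral.unique (hz : IsItoIntegral hW x t z) (hz' : IsItoIntegral hW x t z') :
    z' = z := by
  obtain ⟨u, hux, huz⟩ := hz.exists_approximation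
  exact tendsto_nhds_unique (hz'.tendsto_integral u hux) huz

theorem IsItoIntegral.norm_sub_eq (hz : IsItoIntegral hW x t z) (htT : t ≤ T) (k l : K) :
    ‖z k - z l‖ = ‖restrictTime P htT (x k - x l)‖ := by
  obtain ⟨u, hux, huz⟩ := hz.exists_approximation
  have hx : Tendsto (fun n => ‖restrictTime P htT ((u n).field k - (u n).field l)‖) atTop
      (𝓝 ‖restrictTime P htT (x k - x l)‖) :=
    ((by fun_prop : Continuous fun y : C(K, Lp ℝ 2 (timeProd T P)) =>
      ‖restrictTime P htT (y k - y l)‖).tendsto x).comp hux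
  have hz : Tendsto (fun n => ‖(u n).integral hW t k - (u n).integral hW t l‖) atTop
      (𝓝 ‖z k - z l‖) :=
    ((by fun_prop : Continuous fun y : C(K, Lp ℝ 2 P) => ‖y k - y l‖).tendsto z).comp huz
  refine tendsto_nhds_unique hz (hx.congr fun n => ?_)
  exact (ElementaryProcess.norm_integral_sub_integral hW (u n) (u n) htT k l).symm

theorem IsItoIntegral.isKolmogorovProcess (hz : IsItoIntegral hW x t z)
    (htT : t ≤ T) {β : ℝ} (hβ : 0 < β) {L : Ω → ℝ} (hL : MemLp L 2 P)
    (hxL : ∀ k l, ∀ᵐ p ∂timeProd t P, |x k p - x l p| ≤ L p.2 * dist k l ^ β) :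
    IsKolmogorovProcess (fun k => z k) P 2 (2 * β) (t * (eLpNorm L 2 P).toNNReal ^ 2) := by
  refine .mk_of_secondCountableTopology (fun k => (Lp.stronglyMeasurable (z k)).measurable)
    (fun k l => ?_) two_pos (by positivity)
  have hdist : ‖dist k l ^ β‖ₑ ^ 2 = edist k l ^ (2 * β) := by
    rw [Real.enorm_of_nonneg (by positivity), edist_dist,
      ← ENNReal.ofReal_rpow_of_nonneg dist_nonneg hβ.le, mul_comm, ENNReal.rpow_mul,
      ENNReal.rpow_two]
  calc ∫⁻ ω, edist (z k ω) (z l ω) ^ (2 : ℝ) ∂P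
      = eLpNorm (z k - z l : Ω → ℝ) 2 P ^ 2 := by
        simp_rw [sq_eLpNorm_two, ENNReal.rpow_two, edist_eq_enorm_sub, Pi.sub_apply]
    _ = ‖z k - z l‖ₑ ^ 2 := by rw [Lp.enorm_def, eLpNorm_congr_ae (Lp.coeFn_sub (z k) (z l))]
    _ = ‖restrictTime P htT (x k - x l)‖ₑ ^ 2 := by
        rw [← ofReal_norm, hz.norm_sub_eq htT, ofReal_norm]
    _ ≤ t * eLpNorm L 2 P ^ 2 * ‖dist k l ^ β‖ₑ ^ 2 :=
        sq_enorm_restrictTime_sub_le htT hL.1 (hxL k l)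
    _ = (t * (eLpNorm L 2 P).toNNReal ^ 2 : ℝ≥0) * edist k l ^ (2 * β) := by
        rw [hdist, ENNReal.coe_mul, ENNReal.coe_pow, ENNReal.coe_toNNReal hL.2.ne]

end ItoIntegral

end SpatialIto

theorem proposition5p3 {Ω : Type*} [mΩ : MeasurableSpace Ω] {P : Measure Ω}
    [IsProbabilityMeasure P] {ℱ : Filtration ℝ≥0 mΩ} {W : ℝ≥0 → Ω → ℝ}
    (hW : SpatialIto.IsBrownianMotion W ℱ P)
    {a b : ℝ} (hab : a ≤ b) {T t : ℝ≥0} (htT : t ≤ T)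
    (x : C(Set.Icc a b, Lp ℝ 2 (SpatialIto.timeProd T P)))
    (hx : x ∈ SpatialIto.integrands (Set.Icc a b) ℱ P T)
    {β : ℝ} (hβ : 1 / 2 < β) {L : Ω → ℝ} (hL : MemLp L 2 P)
    (hxL : ∀ τ σ : Set.Icc a b, ∀ᵐ p ∂(SpatialIto.timeProd t P),
      |x τ p - x σ p| ≤ L p.2 * |(τ : ℝ) - (σ : ℝ)| ^ β) :
    ∃ z : C(Set.Icc a b, Lp ℝ 2 P),
      SpatialIto.IsItoIntegral hW x t z ∧
      (∀ z' : C(Set.Icc a b, Lp ℝ 2 P), SpatialIto.IsItoIntegral hW x t z' → z' = z) ∧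
      ∃ Y : Set.Icc a b → Ω → ℝ,
        (∀ σ, Measurable (Y σ)) ∧
        (∀ σ, ∀ᵐ ω ∂P, Y σ ω = z σ ω) ∧
        ∀ γ : ℝ≥0, 0 < γ → (γ : ℝ) < β - 1 / 2 →
          ∀ ω, ∃ C : ℝ≥0, HolderWith C γ (fun σ => Y σ ω) := by
  obtain ⟨z, hz⟩ := SpatialIto.exists_isItoIntegral hW htT hx
  have hkolmogorov := hz.isKolmogorovProcess htT (by linarith) hL hxL
  obtain ⟨Y, hY_meas, hY_ae, hY_holder⟩ :=
    SpatialIto.exists_holder_modification_Icc hab hkolmogorov (by linarith)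
  exact ⟨z, hz, fun z' hz' => hz.unique hz', Y, hY_meas, hY_ae,
    fun γ _ hγ => hY_holder γ (by linarith)⟩
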